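/- Let $r,s\ge 3$ and $\ell\ge 1$ be integers with $r$ even and $s$ odd, and let $D_{r,s,\ell}$ be the dumbbell graph obtained from two vertex-disjoint cycles $C_r$ and $C_s$ by choosing one vertex on each and joining these two vertices by a path of length $\ell$ (so $D_{r,s,\ell}$ has $r+s+\ell-1$ vertices). A complex unit gain graph $\Phi=(D_{r,s,\ell},\varphi)$ is given by a function $\varphi$ that assigns to every oriented edge a complex number of modulus $1$ with $\varphi(u,v)=\varphi(v,u)^{-1}$. Its Hermitian adjacency matrix $A(\Phi)$ has entries $\varphi(u,v)$ for adjacent $u,v$ and $0$ otherwise, and its energy $E(\Phi)$ is the sum of the absolute values of the eigenvalues of $A(\Phi)$, counted with multiplicity. Let $\gamma_r$ and $\gamma_s$ be the gains of the cycles $C_r$ and $C_s$, that is, the products of the gains of their consecutive oriented edges (the real parts do not depend on the starting vertex or the orientation), and put $$\alpha=(-1)^{r/2}\operatorname{Re}\gamma_r,\qquad \beta=(-1)^{(s+1)/2}\operatorname{Re}\gamma_s .$$ Then, among all complex unit gain graphs $\Phi$ on $D_{r,s,\ell}$, the maximum of the energy $E(\Phi)$ is attained exactly when $\alpha=-1$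 and $\beta=\pm1$. That is, $\Phi$ has maximum energy if and only if $\alpha=-1$ and $\beta\in\{1,-1\}$, and both pairs $(\alpha,\beta)=(-1,1)$ and $(\alpha,\beta)=(-1,-1)$ occur. -/

import Mathlib

/-- A complex unit gain function on a simple graph `G`: each oriented edge gets a complex number
of modulus one, and reversing the edge inverts it. -/
structure UnitGain {V : Type*} (G : SimpleGraph V) where
  /-- the gain of an oriented edge -/
  gain : G.Dart → Circle
  gain_symm : ∀ d : G.Dart, gain d.symm = (gain d)⁻¹

namespace UnitGain

variable {V : Type*} {G : SimpleGraph V}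

open Classical in
/-- The Hermitian adjacency matrix of a gain graph. -/
noncomputable def adjMatrix (Φ : UnitGain G) : Matrix V V ℂ :=
  Matrix.of fun u v => if h : G.Adj u v then (Φ.gain ⟨(u, v), h⟩ : ℂ) else 0

theorem adjMatrix_isHermitian (Φ : UnitGain G) : Φ.adjMatrix.IsHermitian := by
  ext u v
  by_cases h : G.Adj u v
  · have h2 : G.Adj v u := h.symm
    have key := Φ.gain_symm ⟨(u, v), h⟩
    have e : (SimpleGraph.Dart.symm ⟨(u, v), h⟩ : G.Dart) = ⟨(v, u), h2⟩ := rfl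
    rw [e] at key
    simp [adjMatrix, Matrix.conjTranspose_apply, h, h2, key, ← Circle.coe_inv_eq_conj]
  · have h2 : ¬ G.Adj v u := fun h' => h h'.symm
    simp [adjMatrix, h, h2]

open Classical in
/-- The energy of a gain graph: the sum of the absolute values of the eigenvalues (with
multiplicity) of its Hermitian adjacency matrix. -/
noncomputable def energy [Fintype V] (Φ : UnitGain G) : ℝ :=
  ∑ j, |Φ.adjMatrix_isHermitian.eigenvalues j|

/-- The gain of the cycle `c 0, c 1, …, c (k - 1), c 0` of `G`: the product of the gains of its
consecutive oriented edges. Here `finRotate k i` is `i + 1` modulo `k`. -/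
noncomputable def cycleGain (Φ : UnitGain G) {k : ℕ} (c : Fin k → V)
    (hc : ∀ i, G.Adj (c i) (c (finRotate k i))) : Circle :=
  ∏ i, Φ.gain ⟨(c i, c (finRotate k i)), hc i⟩

end UnitGain

/-- The dumbbell graph `D_{r,s,ℓ}` (for `3 ≤ r`, `3 ≤ s`, `1 ≤ ℓ`) on the `r + s + ℓ - 1` vertices
`0, 1, …, r + s + ℓ - 2`. The vertices `0, …, r - 1` form the cycle `C_r`, the vertices
`r + ℓ - 1, …, r + s + ℓ - 2` form the cycle `C_s`, and `r - 1, r, …, r + ℓ - 1` is the path of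
length `ℓ` that joins them. So the edges are all pairs of consecutive numbers together with the
closing edges `{0, r - 1}` and `{r + ℓ - 1, r + s + ℓ - 2}` of the two cycles. -/
def dumbbell (r s ℓ : ℕ) : SimpleGraph (Fin (r + s + ℓ - 1)) :=
  SimpleGraph.fromRel fun i j =>
    i.val + 1 = j.val ∨
    (i.val = 0 ∧ j.val + 1 = r) ∨
    (i.val + 1 = r + ℓ ∧ j.val + 2 = r + s + ℓ)

namespace dumbbell

variable {r s ℓ : ℕ}

/-- The vertices of the cycle `C_r`, in cyclic order. -/
def leftCycle (hs : 3 ≤ s) (i : Fin r) : Fin (r + s + ℓ - 1) :=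
  ⟨i.val, by omega⟩

/-- The vertices of the cycle `C_s`, in cyclic order. -/
def rightCycle (hr : 3 ≤ r) (i : Fin s) : Fin (r + s + ℓ - 1) :=
  ⟨r + ℓ - 1 + i.val, by omega⟩

theorem finRotate_val {k : ℕ} (i : Fin k) :
    (i.val + 1 < k ∧ (finRotate k i).val = i.val + 1) ∨
      (i.val + 1 = k ∧ (finRotate k i).val = 0) := by
  cases k with
  | zero => exact i.elim0
  | succ m =>
    by_cases h : i = Fin.last m
    · subst h
      right
      simp
    · left
      have h1 : i.val ≠ m := fun h' => h (Fin.ext h')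
      exact ⟨by omega, coe_finRotate_of_ne_last h⟩

theorem leftCycle_adj (hr : 3 ≤ r) (hs : 3 ≤ s) (i : Fin r) :
    (dumbbell r s ℓ).Adj (leftCycle hs i) (leftCycle hs (finRotate r i)) := by
  have h := finRotate_val i
  simp only [dumbbell, SimpleGraph.fromRel_adj, leftCycle, ne_eq, Fin.mk.injEq]
  omega

theorem rightCycle_adj (hr : 3 ≤ r) (hs : 3 ≤ s) (i : Fin s) :
    (dumbbell r s ℓ).Adj (rightCycle hr i) (rightCycle hr (finRotate s i)) := by
  have h := finRotate_val i
  simp only [dumbbell, SimpleGraph.fromRel_adj, rightCycle, ne_eq, Fin.mk.injEq]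
  omega

/-- The gain `γ_r` of the cycle `C_r`. -/
noncomputable def gainLeft (hr : 3 ≤ r) (hs : 3 ≤ s) (Φ : UnitGain (dumbbell r s ℓ)) : Circle :=
  Φ.cycleGain (leftCycle hs) (leftCycle_adj hr hs)

/-- The gain `γ_s` of the cycle `C_s`. -/
noncomputable def gainRight (hr : 3 ≤ r) (hs : 3 ≤ s) (Φ : UnitGain (dumbbell r s ℓ)) : Circle :=
  Φ.cycleGain (rightCycle hr) (rightCycle_adj hr hs)

/-- `α = (-1)^{r/2} Re γ_r`, used for even `r`. -/
noncomputable def alpha (hr : 3 ≤ r) (hs : 3 ≤ s) (Φ : UnitGain (dumbbell r s ℓ)) : ℝ :=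
  (-1) ^ (r / 2) * (gainLeft hr hs Φ : ℂ).re

/-- `β = (-1)^{(s+1)/2} Re γ_s`, used for odd `s`. -/
noncomputable def beta (hr : 3 ≤ r) (hs : 3 ≤ s) (Φ : UnitGain (dumbbell r s ℓ)) : ℝ :=
  (-1) ^ ((s + 1) / 2) * (gainRight hr hs Φ : ℂ).re

end dumbbell

/-! The energy is compared through a Coulson-type argument: if `∏ (x² + aᵢ²) ≤ ∏ (x² + bᵢ²)` for all
`x > 0`, integrating the logarithm of the quotient over `(0, ∞)` gives `π (∑ |bᵢ| - ∑ |aᵢ|) ≥ 0`,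
strictly if the products differ strictly (`sum_abs_le_of_prod_sq_add_sq_le`,
`sum_abs_lt_of_prod_sq_add_sq_lt`). For eigenvalues the product is `|det (x + iA)|²`.

For a dumbbell this determinant is explicit. With positive path polynomials `p_n`, the even cycle
contributes the real number `p_r + p_{r-2} - 2α` and the odd one the complex number `p_s + p_{s-2} -
2βi`. Cutting the bridge at the odd cycle gives `|det|² = (L_ℓ (p_s + p_{s-2}) + L_{ℓ-1} p_{s-1})² +
4β² L_ℓ²`, where `L_j` is the determinant of the even cycle with a tail, affine in `α` and bounded
in absolute value by its value at `α = -1`. So at every `x > 0` the maximum is reached exactly at `α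
= -1`, `β² = 1` (`dumbbellNormSq_le`, `dumbbellNormSq_lt`). Explicit gains realize both pairs. -/

/-! ### Comparing sums of absolute values by integrating logarithms -/

/-- An antiderivative of `x ↦ log (x ^ 2 + a ^ 2) + 2`. -/
noncomputable def logSqPrimitive (a x : ℝ) : ℝ :=
  x * Real.log (x ^ 2 + a ^ 2) + 2 * |a| * Real.arctan (x / |a|)

theorem logSqPrimitive_zero (a : ℝ) : logSqPrimitive a 0 = 0 := by
  simp [logSqPrimitive]

theorem continuous_logSqPrimitive (a : ℝ) : Continuous (logSqPrimitive a) := by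
  unfold logSqPrimitive
  -- For `a = 0` the logarithm is singular at `0`, but the factor `x` tames it; the arctangent term
  -- is killed by `|0|`.
  rcases eq_or_ne a 0 with rfl | ha
  · have h : (fun x : ℝ => x * Real.log (x ^ 2 + 0 ^ 2) + 2 * |(0 : ℝ)| * Real.arctan (x / |0|)) =
        fun x => 2 * (x * Real.log x) := by
      funext x
      simp [Real.log_pow]
      ring
    rw [h]
    exact continuous_const.mul Real.continuous_mul_log
  · have h : ∀ x : ℝ, x ^ 2 + a ^ 2 ≠ 0 := fun x => by positivity
    fun_prop (disch := assumption)

theorem hasDerivAt_logSqPrimitive (a : ℝ) {x : ℝ} (hx : 0 < x) :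
    HasDerivAt (logSqPrimitive a) (Real.log (x ^ 2 + a ^ 2) + 2) x := by
  have h0 : x ^ 2 + a ^ 2 ≠ 0 := by positivity
  have h1 : HasDerivAt (fun x : ℝ => x ^ 2 + a ^ 2) (2 * x) x := by
    simpa using (hasDerivAt_pow 2 x).add_const (a ^ 2)
  have h2 := (hasDerivAt_id x).mul (h1.log h0)
  have h3 := (((hasDerivAt_id x).div_const |a|).arctan).const_mul (2 * |a|)
  refine (h2.add h3).congr_deriv ?_
  rcases eq_or_ne a 0 with rfl | ha
  · simp
    field_simp
  · have hb : |a| ≠ 0 := abs_ne_zero.mpr ha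
    have h4 : |a| ^ 2 + x ^ 2 ≠ 0 := by positivity
    rw [← sq_abs a] at h0 ⊢
    simp only [id]
    field_simp
    ring

open Filter Topology in
-- The growth `x log x²` does not depend on `a`, so it cancels in differences; what remains is `2|a|
-- · π/2` from the arctangent.
theorem tendsto_logSqPrimitive_sub (a : ℝ) :
    Tendsto (fun x => logSqPrimitive a x - x * Real.log (x ^ 2)) atTop (𝓝 (Real.pi * |a|)) := by
  have h1 : Tendsto (fun x : ℝ => x * Real.log (x ^ 2 + a ^ 2) - x * Real.log (x ^ 2))
      atTop (𝓝 0) := by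
    have hlim : Tendsto (fun x : ℝ => a ^ 2 / x) atTop (𝓝 0) :=
      tendsto_const_nhds.div_atTop tendsto_id
    refine tendsto_of_tendsto_of_tendsto_of_le_of_le' tendsto_const_nhds hlim ?_ ?_
    · filter_upwards [eventually_gt_atTop 0] with x hx
      rw [← mul_sub]
      refine mul_nonneg hx.le (sub_nonneg.mpr (Real.log_le_log (by positivity) ?_))
      nlinarith [sq_nonneg a]
    · filter_upwards [eventually_gt_atTop 0] with x hx
      rw [← mul_sub, ← Real.log_div (by positivity) (by positivity)]
      -- `log y ≤ y - 1` bounds the difference by `a² / x`.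
      have := Real.log_le_sub_one_of_pos (x := (x ^ 2 + a ^ 2) / x ^ 2) (by positivity)
      calc x * Real.log ((x ^ 2 + a ^ 2) / x ^ 2)
          ≤ x * ((x ^ 2 + a ^ 2) / x ^ 2 - 1) := mul_le_mul_of_nonneg_left this hx.le
        _ = a ^ 2 / x := by field_simp; ring
  have h2 : Tendsto (fun x : ℝ => 2 * |a| * Real.arctan (x / |a|)) atTop (𝓝 (Real.pi * |a|)) := by
    rcases eq_or_ne a 0 with rfl | ha
    · simp
    · have hb : 0 < |a| := abs_pos.mpr ha
      have := ((Real.tendsto_arctan_atTop.mono_right nhdsWithin_le_nhds).comp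
        (tendsto_id.atTop_div_const hb)).const_mul (2 * |a|)
      convert! this using 2
      ring
  have h3 := h1.add h2
  rw [zero_add] at h3
  refine h3.congr fun x => ?_
  unfold logSqPrimitive
  ring

open Filter Topology in
theorem tendsto_sum_logSqPrimitive_sub {ι : Type*} [Fintype ι] (a b : ι → ℝ) :
    Tendsto (fun x => ∑ i, logSqPrimitive (b i) x - ∑ i, logSqPrimitive (a i) x) atTop
      (𝓝 (Real.pi * (∑ i, |b i| - ∑ i, |a i|))) := by
  have h := (tendsto_finsetSum Finset.univ fun i _ => tendsto_logSqPrimitive_sub (b i)).sub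
    (tendsto_finsetSum Finset.univ fun i _ => tendsto_logSqPrimitive_sub (a i))
  rw [mul_sub, Finset.mul_sum, Finset.mul_sum]
  refine h.congr fun x => ?_
  simp only [Finset.sum_sub_distrib]
  ring

theorem hasDerivAt_sum_logSqPrimitive_sub {ι : Type*} [Fintype ι] (a b : ι → ℝ) {x : ℝ}
    (hx : 0 < x) :
    HasDerivAt (fun x => ∑ i, logSqPrimitive (b i) x - ∑ i, logSqPrimitive (a i) x)
      (Real.log (∏ i, (x ^ 2 + b i ^ 2)) - Real.log (∏ i, (x ^ 2 + a i ^ 2))) x := by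
  have h := (HasDerivAt.fun_sum fun i (_ : i ∈ Finset.univ) =>
    hasDerivAt_logSqPrimitive (b i) hx).sub
    (HasDerivAt.fun_sum fun i (_ : i ∈ Finset.univ) => hasDerivAt_logSqPrimitive (a i) hx)
  refine h.congr_deriv ?_
  rw [Real.log_prod fun i _ => by positivity, Real.log_prod fun i _ => by positivity]
  simp only [Finset.sum_add_distrib]
  ring

theorem continuous_sum_logSqPrimitive_sub {ι : Type*} [Fintype ι] (a b : ι → ℝ) :
    Continuous (fun x => ∑ i, logSqPrimitive (b i) x - ∑ i, logSqPrimitive (a i) x) :=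
  (continuous_finsetSum _ fun i _ => continuous_logSqPrimitive (b i)).sub
    (continuous_finsetSum _ fun i _ => continuous_logSqPrimitive (a i))

theorem sum_abs_le_of_prod_sq_add_sq_le {ι : Type*} [Fintype ι] {a b : ι → ℝ}
    (h : ∀ x : ℝ, 0 < x → ∏ i, (x ^ 2 + a i ^ 2) ≤ ∏ i, (x ^ 2 + b i ^ 2)) :
    ∑ i, |a i| ≤ ∑ i, |b i| := by
  have hmono : MonotoneOn
      (fun x => ∑ i, logSqPrimitive (b i) x - ∑ i, logSqPrimitive (a i) x) (Set.Ici 0) := by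
    refine monotoneOn_of_deriv_nonneg (convex_Ici 0)
      (continuous_sum_logSqPrimitive_sub a b).continuousOn ?_ ?_
    · intro x hx
      rw [interior_Ici] at hx
      exact (hasDerivAt_sum_logSqPrimitive_sub a b hx).differentiableAt.differentiableWithinAt
    · intro x hx
      rw [interior_Ici] at hx
      rw [(hasDerivAt_sum_logSqPrimitive_sub a b hx).deriv]
      have hx' : 0 < x := hx
      exact sub_nonneg.mpr (Real.log_le_log (Finset.prod_pos fun i _ => by positivity) (h x hx))
  have h0 : 0 ≤ Real.pi * (∑ i, |b i| - ∑ i, |a i|) := by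
    refine ge_of_tendsto (tendsto_sum_logSqPrimitive_sub a b) ?_
    filter_upwards [Filter.eventually_ge_atTop 0] with x hx
    simpa [logSqPrimitive_zero] using hmono (Set.self_mem_Ici) hx hx
  exact sub_nonneg.mp (nonneg_of_mul_nonneg_right h0 Real.pi_pos)

theorem sum_abs_lt_of_prod_sq_add_sq_lt {ι : Type*} [Fintype ι] {a b : ι → ℝ}
    (h : ∀ x : ℝ, 0 < x → ∏ i, (x ^ 2 + a i ^ 2) < ∏ i, (x ^ 2 + b i ^ 2)) :
    ∑ i, |a i| < ∑ i, |b i| := by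
  have hmono : StrictMonoOn
      (fun x => ∑ i, logSqPrimitive (b i) x - ∑ i, logSqPrimitive (a i) x) (Set.Ici 0) := by
    refine strictMonoOn_of_deriv_pos (convex_Ici 0)
      (continuous_sum_logSqPrimitive_sub a b).continuousOn fun x hx => ?_
    rw [interior_Ici] at hx
    rw [(hasDerivAt_sum_logSqPrimitive_sub a b hx).deriv]
    have hx' : 0 < x := hx
    exact sub_pos.mpr (Real.log_lt_log (Finset.prod_pos fun i _ => by positivity) (h x hx))
  -- A limit alone would only give `≤`. The value at `1` is already positive, and the limit is at
  -- least that value.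
  have h1 := hmono (Set.self_mem_Ici) (Set.mem_Ici.mpr zero_le_one) zero_lt_one
  have h0 := ge_of_tendsto (tendsto_sum_logSqPrimitive_sub a b)
    (b := ∑ i, logSqPrimitive (b i) 1 - ∑ i, logSqPrimitive (a i) 1) (by
      filter_upwards [Filter.eventually_ge_atTop 1] with x hx
      exact hmono.monotoneOn (Set.mem_Ici.mpr zero_le_one)
        (Set.mem_Ici.mpr (zero_le_one.trans hx)) hx)
  simp only [logSqPrimitive_zero, Finset.sum_const_zero, sub_zero] at h1
  exact sub_pos.mp (pos_of_mul_pos_right (h1.trans_le h0) Real.pi_pos.le)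

/-! ### The spectrum seen through `det (x + iA)` -/

theorem Matrix.IsHermitian.normSq_det_smul_one_add_I_smul {n : Type*} [Fintype n] [DecidableEq n]
    {A : Matrix n n ℂ} (hA : A.IsHermitian) (x : ℝ) :
    Complex.normSq ((x : ℂ) • (1 : Matrix n n ℂ) + Complex.I • A).det =
      ∏ i, (x ^ 2 + hA.eigenvalues i ^ 2) := by
  have h := congrArg (Polynomial.eval (Complex.I * x)) hA.charpoly_eq
  rw [Matrix.eval_charpoly, Polynomial.eval_prod] at h
  -- Up to the unimodular factor `(-i)^n`, the determinant is the characteristic polynomial at `ix`,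
  -- and `|ix - λ|² = x² + λ²`.
  have e : (x : ℂ) • (1 : Matrix n n ℂ) + Complex.I • A =
      (-Complex.I) • (Matrix.scalar n (Complex.I * x) - A) := by
    rw [smul_sub, Matrix.scalar_apply, ← Matrix.smul_one_eq_diagonal, smul_smul, ← mul_assoc,
      neg_mul, Complex.I_mul_I, neg_neg, one_mul, neg_smul, sub_neg_eq_add]
  rw [e, Matrix.det_smul, h]
  simp only [map_mul, map_pow, map_prod]
  simp [Complex.normSq_apply]
  refine Finset.prod_congr rfl fun i _ => ?_
  ring

theorem Matrix.IsHermitian.det_smul_one_add_I_smul_ne_zero {n : Type*} [Fintype n] [DecidableEq n]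
    {A : Matrix n n ℂ} (hA : A.IsHermitian) {x : ℝ} (hx : 0 < x) :
    ((x : ℂ) • (1 : Matrix n n ℂ) + Complex.I • A).det ≠ 0 := by
  rw [← Complex.normSq_pos, hA.normSq_det_smul_one_add_I_smul]
  exact Finset.prod_pos fun i _ => by positivity

/-! ### Schur complements for one linking edge and for one added vertex -/

namespace Matrix

variable {m n R : Type*} [Fintype m] [DecidableEq m] [Fintype n] [DecidableEq n] [CommRing R]

theorem det_sub_single_self (D : Matrix n n R) (v : n) (t : R) :
    (D - single v v t).det = D.det - t * D.adjugate v v := by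
  have h : D - single v v t = D.updateRow v (D v + (-t) • Pi.single v 1) := by
    ext i j
    rcases eq_or_ne i v with rfl | hi
    · rcases eq_or_ne i j with rfl | hj
      · simp [sub_eq_add_neg]
      · simp [hj, hj.symm]
    · simp [hi, hi.symm]
  rw [h, det_updateRow_add, det_updateRow_smul, updateRow_eq_self, adjugate_apply]
  ring

theorem det_mul_inv_apply {A : Matrix m m R} (hA : IsUnit A.det) (i j : m) :
    A.det * A⁻¹ i j = A.adjugate i j := by
  rw [inv_def, smul_apply, smul_eq_mul, ← mul_assoc, Ring.mul_inverse_cancel _ hA, one_mul]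

/-- The Schur complement changes only the entry `(v, v)` of `D`. With adjugates in place of
inverses, the result involves only minors, which are determinants of vertex-deleted graphs. -/
theorem det_fromBlocks_single_single {A : Matrix m m R} (hA : IsUnit A.det) (D : Matrix n n R)
    (u : m) (v : n) (b c : R) :
    (fromBlocks A (single u v b) (single v u c) D).det =
      A.det * D.det - b * c * A.adjugate u u * D.adjugate v v := by
  have := invertibleOfIsUnitDet A hA
  rw [det_fromBlocks₁₁, invOf_eq_nonsing_inv, single_mul_mul_single, det_sub_single_self, mul_sub,
    ← det_mul_inv_apply hA]
  ring

theorem det_fromBlocks_unique [Unique n] {A : Matrix m m R} (hA : IsUnit A.det)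
    (B : Matrix m n R) (C : Matrix n m R) (D : Matrix n n R) :
    (fromBlocks A B C D).det = A.det * D default default -
      ∑ j, ∑ i, C default i * A.adjugate i j * B j default := by
  have := invertibleOfIsUnitDet A hA
  rw [det_fromBlocks₁₁, invOf_eq_nonsing_inv, det_unique (D - _), sub_apply, mul_sub, mul_apply,
    Finset.mul_sum]
  congr 1
  refine Finset.sum_congr rfl fun j _ => ?_
  rw [mul_apply, Finset.sum_mul, Finset.mul_sum]
  refine Finset.sum_congr rfl fun i _ => ?_
  rw [← det_mul_inv_apply hA]
  ring

end Matrix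

/-! ### Leading blocks of infinite matrices and bridges -/

/-- The leading `k × k` block of the infinite matrix `x + i H`. -/
noncomputable def leadingBlock (x : ℝ) (H : ℕ → ℕ → ℂ) (k : ℕ) : Matrix (Fin k) (Fin k) ℂ :=
  (x : ℂ) • 1 + Complex.I • Matrix.of fun i j : Fin k => H i j

/-- An infinite matrix without its first `a` rows and columns. -/
def shiftMatrix (a : ℕ) (H : ℕ → ℕ → ℂ) (i j : ℕ) : ℂ := H (a + i) (a + j)

/-- An infinite matrix that is equal to its conjugate transpose. -/
def IsHermitianNat (H : ℕ → ℕ → ℂ) : Prop := ∀ i j, H j i = (starRingEnd ℂ) (H i j)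

theorem IsHermitianNat.shift {H : ℕ → ℕ → ℂ} (hH : IsHermitianNat H) (a : ℕ) :
    IsHermitianNat (shiftMatrix a H) := fun _ _ => hH _ _

theorem leadingBlock_apply (x : ℝ) (H : ℕ → ℕ → ℂ) {k : ℕ} (i j : Fin k) :
    leadingBlock x H k i j = (if i = j then (x : ℂ) else 0) + Complex.I * H i j := by
  simp [leadingBlock, Matrix.one_apply]

theorem leadingBlock_apply_of_ne (x : ℝ) (H : ℕ → ℕ → ℂ) {k : ℕ} {i j : Fin k} (h : i ≠ j) :
    leadingBlock x H k i j = Complex.I * H i j := by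
  simp [leadingBlock_apply, h]

theorem IsHermitianNat.isUnit_det_leadingBlock {H : ℕ → ℕ → ℂ} (hH : IsHermitianNat H) {x : ℝ}
    (hx : 0 < x) (k : ℕ) : IsUnit (leadingBlock x H k).det := by
  refine (Matrix.IsHermitian.det_smul_one_add_I_smul_ne_zero ?_ hx).isUnit
  ext i j
  simp [Matrix.conjTranspose_apply, hH i j]

theorem leadingBlock_submatrix_castSucc (x : ℝ) (H : ℕ → ℕ → ℂ) (k : ℕ) :
    (leadingBlock x H (k + 1)).submatrix Fin.castSucc Fin.castSucc = leadingBlock x H k := by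
  ext i j
  simp [leadingBlock_apply]

theorem leadingBlock_submatrix_succ (x : ℝ) (H : ℕ → ℕ → ℂ) (k : ℕ) :
    (leadingBlock x H (k + 1)).submatrix Fin.succ Fin.succ =
      leadingBlock x (shiftMatrix 1 H) k := by
  ext i j
  simp [leadingBlock_apply, shiftMatrix, add_comm]

theorem adjugate_leadingBlock_last (x : ℝ) (H : ℕ → ℕ → ℂ) (k : ℕ) :
    (leadingBlock x H (k + 1)).adjugate (Fin.last k) (Fin.last k) = (leadingBlock x H k).det := by
  rw [Matrix.adjugate_fin_succ_eq_det_submatrix, Fin.succAbove_last,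
    leadingBlock_submatrix_castSucc, Even.neg_one_pow (Even.add_self _), one_mul]

theorem adjugate_leadingBlock_zero (x : ℝ) (H : ℕ → ℕ → ℂ) (k : ℕ) :
    (leadingBlock x H (k + 1)).adjugate 0 0 = (leadingBlock x (shiftMatrix 1 H) k).det := by
  rw [Matrix.adjugate_fin_succ_eq_det_submatrix, Fin.succAbove_zero,
    leadingBlock_submatrix_succ, Even.neg_one_pow (Even.add_self _), one_mul]

theorem shiftMatrix_shiftMatrix (a b : ℕ) (H : ℕ → ℕ → ℂ) :
    shiftMatrix b (shiftMatrix a H) = shiftMatrix (a + b) H := by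
  funext i j
  simp [shiftMatrix, add_assoc]

/-- Cutting a bridge between the consecutive vertices `m` and `m + 1`. -/
theorem det_leadingBlock_of_bridge {x : ℝ} (hx : 0 < x) {H : ℕ → ℕ → ℂ} (hH : IsHermitianNat H)
    (m n : ℕ) (hb : Complex.normSq (H m (m + 1)) = 1)
    (h0 : ∀ i j, i ≤ m → m < j → j < m + 1 + (n + 1) → (i ≠ m ∨ j ≠ m + 1) → H i j = 0) :
    (leadingBlock x H (m + 1 + (n + 1))).det =
      (leadingBlock x H (m + 1)).det * (leadingBlock x (shiftMatrix (m + 1) H) (n + 1)).det +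
      (leadingBlock x H m).det * (leadingBlock x (shiftMatrix (m + 2) H) n).det := by
  have e : (leadingBlock x H (m + 1 + (n + 1))).submatrix finSumFinEquiv finSumFinEquiv =
      Matrix.fromBlocks (leadingBlock x H (m + 1))
        (Matrix.single (Fin.last m) 0 (Complex.I * H m (m + 1)))
        (Matrix.single 0 (Fin.last m) (Complex.I * H (m + 1) m))
        (leadingBlock x (shiftMatrix (m + 1) H) (n + 1)) := by
    have hB : ∀ (i : Fin (m + 1)) (j : Fin (n + 1)), ¬(Fin.last m = i ∧ 0 = j) →
        H i (m + 1 + j) = 0 := by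
      intro i j hij
      apply h0 <;> simp only [Fin.ext_iff, Fin.val_last, Fin.val_zero] at * <;> omega
    have hne : ∀ (i : Fin (m + 1)) (j : Fin (n + 1)), Fin.castAdd (n + 1) i ≠ Fin.natAdd (m + 1) j := by
      intro i j hij
      have := congrArg Fin.val hij
      simp at this
      omega
    ext (i | i) (j | j)
    · simp [leadingBlock_apply, Fin.ext_iff]
    · simp only [Matrix.submatrix_apply, finSumFinEquiv_apply_left, finSumFinEquiv_apply_right,
        Matrix.fromBlocks_apply₁₂, leadingBlock_apply_of_ne x H (hne i j), Matrix.single_apply]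
      split_ifs with h
      · rw [← h.1, ← h.2]; simp
      · simp [hB i j h]
    · simp only [Matrix.submatrix_apply, finSumFinEquiv_apply_left, finSumFinEquiv_apply_right,
        Matrix.fromBlocks_apply₂₁, leadingBlock_apply_of_ne x H (hne j i).symm, Matrix.single_apply]
      split_ifs with h
      · rw [← h.1, ← h.2]; simp
      · have := hB j i (fun h' => h h'.symm)
        simp [hH j (m + 1 + i), this]
    · simp [leadingBlock_apply, Fin.ext_iff, shiftMatrix]
  rw [← Matrix.det_submatrix_equiv_self finSumFinEquiv, e,
    Matrix.det_fromBlocks_single_single (hH.isUnit_det_leadingBlock hx _),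
    adjugate_leadingBlock_last, adjugate_leadingBlock_zero, shiftMatrix_shiftMatrix, hH m (m + 1)]
  -- The factor `i² = -1` reverses the sign in the Schur formula, so the gain of a bridge disappears
  -- and both terms enter with a plus.
  have h1 : Complex.I * H m (m + 1) * (Complex.I * (starRingEnd ℂ) (H m (m + 1))) = -1 := by
    rw [mul_mul_mul_comm, Complex.I_mul_I, Complex.mul_conj, hb]
    simp
  rw [h1]
  ring

theorem det_leadingBlock_zero (x : ℝ) (H : ℕ → ℕ → ℂ) : (leadingBlock x H 0).det = 1 :=
  Matrix.det_isEmpty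

theorem det_leadingBlock_one (x : ℝ) (H : ℕ → ℕ → ℂ) (h : H 0 0 = 0) :
    (leadingBlock x H 1).det = x := by
  simp [leadingBlock_apply, h]

theorem det_leadingBlock_add_two {x : ℝ} (hx : 0 < x) {H : ℕ → ℕ → ℂ} (hH : IsHermitianNat H)
    (m : ℕ) (hb : Complex.normSq (H m (m + 1)) = 1) (hd : H (m + 1) (m + 1) = 0)
    (h0 : ∀ i, i < m → H i (m + 1) = 0) :
    (leadingBlock x H (m + 2)).det =
      x * (leadingBlock x H (m + 1)).det + (leadingBlock x H m).det := by
  have h := det_leadingBlock_of_bridge hx hH m 0 hb (fun i j hi hj hj' hij => by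
    obtain rfl : j = m + 1 := by omega
    exact h0 i (by omega))
  rw [det_leadingBlock_one _ _ (by simpa [shiftMatrix] using hd), det_leadingBlock_zero] at h
  rw [h]
  ring

/-! ### Determinants of paths and cycles -/

/-- The matching polynomials of paths, up to powers of `i`. -/
def pathPoly (x : ℝ) : ℕ → ℝ
  | 0 => 1
  | 1 => x
  | n + 2 => x * pathPoly x (n + 1) + pathPoly x n

theorem pathPoly_pos {x : ℝ} (hx : 0 < x) : ∀ n, 0 < pathPoly x n
  | 0 => one_pos
  | 1 => hx
  | n + 2 => add_pos (mul_pos hx (pathPoly_pos hx (n + 1))) (pathPoly_pos hx n)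

/-- The leading `n × n` block is the adjacency matrix of a gain graph on the path
`0, 1, …, n - 1`. -/
structure IsPathMatrix (H : ℕ → ℕ → ℂ) (n : ℕ) : Prop where
  diag : ∀ i, i < n → H i i = 0
  normSq_succ : ∀ i, i + 1 < n → Complex.normSq (H i (i + 1)) = 1
  eq_zero : ∀ i j, i + 1 < j → j < n → H i j = 0

theorem IsPathMatrix.mono {H : ℕ → ℕ → ℂ} {m n : ℕ} (h : IsPathMatrix H n) (hmn : m ≤ n) :
    IsPathMatrix H m :=
  ⟨fun i hi => h.diag i (by omega), fun i hi => h.normSq_succ i (by omega),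
    fun i j hij hj => h.eq_zero i j hij (by omega)⟩

theorem IsPathMatrix.shift {H : ℕ → ℕ → ℂ} {n : ℕ} (a : ℕ) (h : IsPathMatrix H (a + n)) :
    IsPathMatrix (shiftMatrix a H) n :=
  ⟨fun i hi => h.diag _ (by omega), fun i hi => h.normSq_succ _ (by omega),
    fun i j hij hj => h.eq_zero _ _ (by omega) (by omega)⟩

theorem det_leadingBlock_of_isPathMatrix {x : ℝ} (hx : 0 < x) {H : ℕ → ℕ → ℂ}
    (hH : IsHermitianNat H) : ∀ n, IsPathMatrix H n → (leadingBlock x H n).det = pathPoly x n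
  | 0, _ => by rw [det_leadingBlock_zero, pathPoly, Complex.ofReal_one]
  | 1, h => by rw [det_leadingBlock_one x H (h.diag 0 one_pos), pathPoly]
  | n + 2, h => by
    rw [det_leadingBlock_add_two hx hH n (h.normSq_succ n (by omega)) (h.diag _ (by omega))
      (fun i hi => h.eq_zero i _ (by omega) (by omega)),
      det_leadingBlock_of_isPathMatrix hx hH (n + 1) (h.mono (by omega)),
      det_leadingBlock_of_isPathMatrix hx hH n (h.mono (by omega)), pathPoly]
    push_cast
    ring

/-- Deleting the last row and the first column of a path matrix moves the superdiagonal onto the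
diagonal and leaves a lower triangular matrix. -/
theorem adjugate_leadingBlock_zero_last (x : ℝ) {H : ℕ → ℕ → ℂ} {k : ℕ}
    (h : IsPathMatrix H (k + 1)) :
    (leadingBlock x H (k + 1)).adjugate 0 (Fin.last k) =
      (-1) ^ k * ∏ i : Fin k, (Complex.I * H i (i + 1)) := by
  rw [Matrix.adjugate_fin_succ_eq_det_submatrix, Fin.succAbove_last, Fin.succAbove_zero]
  rw [Matrix.det_of_isLowerTriangular]
  · simp only [Fin.val_last, Fin.val_zero, add_zero]
    congr 1
    refine Finset.prod_congr rfl fun i _ => ?_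
    rw [Matrix.submatrix_apply, leadingBlock_apply_of_ne x H (Fin.castSucc_lt_succ).ne]
    simp
  · intro i j hij
    have hij' : i.val < j.val := hij
    have hne : i.castSucc ≠ j.succ := by simp [Fin.ext_iff]; omega
    rw [Matrix.submatrix_apply, leadingBlock_apply_of_ne x H hne,
      h.eq_zero _ _ (by simpa using hij') (by simp), mul_zero]

theorem adjugate_leadingBlock_last_zero (x : ℝ) {H : ℕ → ℕ → ℂ} (hH : IsHermitianNat H) {k : ℕ}
    (h : IsPathMatrix H (k + 1)) :
    (leadingBlock x H (k + 1)).adjugate (Fin.last k) 0 =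
      (-1) ^ k * ∏ i : Fin k, (Complex.I * (starRingEnd ℂ) (H i (i + 1))) := by
  rw [Matrix.adjugate_fin_succ_eq_det_submatrix, Fin.succAbove_last, Fin.succAbove_zero]
  rw [Matrix.det_of_isUpperTriangular]
  · simp only [Fin.val_last, Fin.val_zero, zero_add]
    congr 1
    refine Finset.prod_congr rfl fun i _ => ?_
    rw [Matrix.submatrix_apply, leadingBlock_apply_of_ne x H (Fin.castSucc_lt_succ).ne', ← hH]
    simp
  · intro i j hij
    have hij' : j.val < i.val := hij
    have hne : i.succ ≠ j.castSucc := by simp [Fin.ext_iff]; omega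
    rw [Matrix.submatrix_apply, leadingBlock_apply_of_ne x H hne, hH j.castSucc i.succ,
      h.eq_zero _ _ (by simpa using hij') (by simp), map_zero, mul_zero]

/-- The vertex `k + 2` closes a path into a cycle. It meets only the two ends of the path, so the
Schur sum has four terms: the two diagonal minors each give a shorter path, and the two corner
minors give the cycle gain and its conjugate, hence twice a real part. -/
theorem det_leadingBlock_of_isCycle {x : ℝ} (hx : 0 < x) {H : ℕ → ℕ → ℂ} (hH : IsHermitianNat H)
    (k : ℕ) (hp : IsPathMatrix H (k + 2)) (hd : H (k + 2) (k + 2) = 0)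
    (h1 : Complex.normSq (H (k + 1) (k + 2)) = 1) (h2 : Complex.normSq (H (k + 2) 0) = 1)
    (h0 : ∀ i, 0 < i → i < k + 1 → H i (k + 2) = 0) :
    (leadingBlock x H (k + 3)).det = (pathPoly x (k + 3) + pathPoly x (k + 1) : ℝ) +
      (-1) ^ k * Complex.I ^ (k + 3) *
        (2 * (((∏ i ∈ Finset.range (k + 2), H i (i + 1)) * H (k + 2) 0).re : ℂ)) := by
  have e : (leadingBlock x H (k + 2 + 1)).submatrix finSumFinEquiv finSumFinEquiv =
      Matrix.fromBlocks (leadingBlock x H (k + 2))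
        (Matrix.of fun i (_ : Fin 1) => Complex.I * H i (k + 2))
        (Matrix.of fun (_ : Fin 1) j => Complex.I * H (k + 2) j)
        (Matrix.of fun _ _ => (x : ℂ)) := by
    have hne : ∀ (i : Fin (k + 2)) (j : Fin 1), Fin.castAdd 1 i ≠ Fin.natAdd (k + 2) j := by
      intro i j hij
      have := congrArg Fin.val hij
      simp at this
      omega
    ext (i | i) (j | j)
    · simp [leadingBlock_apply, Fin.ext_iff]
    · simp [leadingBlock_apply_of_ne x H (hne i j)]
    · simp [leadingBlock_apply_of_ne x H (hne j i).symm]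
    · simp [leadingBlock_apply, hd, Subsingleton.elim i j]
  have hsum : ∀ f : Fin (k + 2) → ℂ, (∀ i, i ≠ 0 ∧ i ≠ Fin.last (k + 1) → f i = 0) →
      ∑ i, f i = f 0 + f (Fin.last (k + 1)) := fun f hf =>
    Fintype.sum_eq_add _ _ (Fin.last_pos.ne) hf
  have hmid : ∀ i : Fin (k + 2), i ≠ 0 ∧ i ≠ Fin.last (k + 1) → H i (k + 2) = 0 := by
    rintro i ⟨hi, hi'⟩
    rw [ne_eq, Fin.ext_iff] at hi hi'
    simp only [Fin.val_last, Fin.val_zero] at hi hi'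
    exact h0 i (by omega) (by omega)
  have hre : ∀ z : ℂ, 2 * (z.re : ℂ) = z + (starRingEnd ℂ) z := fun z => by
    rw [Complex.add_conj, Complex.ofReal_mul, Complex.ofReal_ofNat]
  change (leadingBlock x H (k + 2 + 1)).det = _
  rw [← Matrix.det_submatrix_equiv_self finSumFinEquiv, e,
    Matrix.det_fromBlocks_unique (hH.isUnit_det_leadingBlock hx _), hsum, hsum, hsum,
    adjugate_leadingBlock_last, adjugate_leadingBlock_zero, adjugate_leadingBlock_zero_last x hp,
    adjugate_leadingBlock_last_zero x hH hp, det_leadingBlock_of_isPathMatrix hx hH _ hp,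
    det_leadingBlock_of_isPathMatrix hx hH _ (hp.mono (Nat.le_succ _)),
    det_leadingBlock_of_isPathMatrix hx (hH.shift 1) (k + 1)
      (IsPathMatrix.shift 1 (hp.mono (by omega))), Finset.prod_mul_distrib, Finset.prod_mul_distrib,
    ← map_prod, Finset.prod_range_succ, Finset.prod_range, hre]
  · simp only [Matrix.of_apply, Fin.val_zero, Fin.val_last, Finset.prod_const, Finset.card_univ,
      Fintype.card_fin, pathPoly, map_mul]
    have e1 : H 0 (k + 2) = (starRingEnd ℂ) (H (k + 2) 0) := hH _ _
    have e2 : H (k + 2) (k + 1) = (starRingEnd ℂ) (H (k + 1) (k + 2)) := hH _ _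
    have e3 : H (k + 2) 0 * (starRingEnd ℂ) (H (k + 2) 0) = 1 := by
      rw [Complex.mul_conj, h2, Complex.ofReal_one]
    have e4 : H (k + 1) (k + 2) * (starRingEnd ℂ) (H (k + 1) (k + 2)) = 1 := by
      rw [Complex.mul_conj, h1, Complex.ofReal_one]
    rw [e1, e2]
    push_cast
    generalize H (k + 2) 0 = w at *
    generalize H (k + 1) (k + 2) = v at *
    generalize ∏ i : Fin (k + 1), H i (i + 1) = P at *
    linear_combination (-((pathPoly x (k + 1) : ℝ) : ℂ) * w * (starRingEnd ℂ) w
      - ((pathPoly x (k + 1) : ℝ) : ℂ) * v * (starRingEnd ℂ) v) * Complex.I_sq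
      + ((pathPoly x (k + 1) : ℝ) : ℂ) * e3 + ((pathPoly x (k + 1) : ℝ) : ℂ) * e4
  · intro j hj
    simp [hH j (k + 2), hmid j hj]
  · intro j hj
    simp [hH j (k + 2), hmid j hj]
  · intro j hj
    simp [hmid j hj]

/-! ### The determinant of a dumbbell -/

/-- The solution of the recursion `f (n + 2) = x f (n + 1) + f n` with initial values `u`, `v`. -/
def continuantSeq (x u v : ℝ) : ℕ → ℝ
  | 0 => u
  | 1 => v
  | n + 2 => x * continuantSeq x u v (n + 1) + continuantSeq x u v n

theorem continuantSeq_nonneg {x u v : ℝ} (hx : 0 < x) (hu : 0 ≤ u) (hv : 0 ≤ v) :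
    ∀ n, 0 ≤ continuantSeq x u v n
  | 0 => hu
  | 1 => hv
  | n + 2 => add_nonneg (mul_nonneg hx.le (continuantSeq_nonneg hx hu hv (n + 1)))
      (continuantSeq_nonneg hx hu hv n)

theorem continuantSeq_succ_pos {x u v : ℝ} (hx : 0 < x) (hu : 0 ≤ u) (hv : 0 < v) :
    ∀ n, 0 < continuantSeq x u v (n + 1)
  | 0 => hv
  | n + 1 => add_pos_of_pos_of_nonneg (mul_pos hx (continuantSeq_succ_pos hx hu hv n))
      (continuantSeq_nonneg hx hu hv.le n)

/-- The leading `k + 3 + l + (t + 3)` block is the adjacency matrix of a gain graph on the dumbbell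
`D_{k+3,t+3,l+1}`. -/
structure IsDumbbellMatrix (H : ℕ → ℕ → ℂ) (k t l : ℕ) : Prop where
  diag : ∀ i, i < k + 3 + l + (t + 3) → H i i = 0
  normSq_succ : ∀ i, i + 1 < k + 3 + l + (t + 3) → Complex.normSq (H i (i + 1)) = 1
  normSq_left : Complex.normSq (H (k + 2) 0) = 1
  normSq_right : Complex.normSq (H (k + 3 + l + (t + 2)) (k + 3 + l)) = 1
  eq_zero : ∀ i j, i + 1 < j → j < k + 3 + l + (t + 3) → ¬(i = 0 ∧ j = k + 2) →
    ¬(i = k + 3 + l ∧ j = k + 3 + l + (t + 2)) → H i j = 0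

namespace IsDumbbellMatrix

variable {H : ℕ → ℕ → ℂ} {k t l : ℕ} {x : ℝ}

theorem isPathMatrix_left (h : IsDumbbellMatrix H k t l) : IsPathMatrix H (k + 2) :=
  ⟨fun i hi => h.diag i (by omega), fun i hi => h.normSq_succ i (by omega),
    fun i j hij hj => h.eq_zero i j hij (by omega) (by omega) (by omega)⟩

theorem isPathMatrix_right (h : IsDumbbellMatrix H k t l) :
    IsPathMatrix (shiftMatrix (k + 3 + l) H) (t + 2) :=
  ⟨fun i hi => h.diag _ (by omega), fun i hi => h.normSq_succ _ (by omega),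
    fun i j hij hj => h.eq_zero _ _ (by omega) (by omega) (by omega) (by omega)⟩

theorem isPathMatrix_right_tail (h : IsDumbbellMatrix H k t l) :
    IsPathMatrix (shiftMatrix (k + 4 + l) H) (t + 2) :=
  ⟨fun i hi => h.diag _ (by omega), fun i hi => h.normSq_succ (k + 4 + l + i) (by omega),
    fun i j hij hj => h.eq_zero _ _ (by omega) (by omega) (by omega) (by omega)⟩

theorem det_left (hx : 0 < x) (hH : IsHermitianNat H) (h : IsDumbbellMatrix H k t l)
    (hk : Even (k + 3)) :
    (leadingBlock x H (k + 3)).det = (pathPoly x (k + 3) + pathPoly x (k + 1) -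
      2 * ((-1) ^ ((k + 3) / 2) *
        ((∏ i ∈ Finset.range (k + 2), H i (i + 1)) * H (k + 2) 0).re) : ℝ) := by
  rw [det_leadingBlock_of_isCycle hx hH k h.isPathMatrix_left (h.diag _ (by omega))
    (h.normSq_succ (k + 1) (by omega)) h.normSq_left
    fun i hi hi' => h.eq_zero _ _ (by omega) (by omega) (by omega) (by omega)]
  have hodd : Odd k := by
    rw [← Nat.not_even_iff_odd]
    intro hk'
    obtain ⟨a, ha⟩ := hk
    obtain ⟨b, hb⟩ := hk'
    omega
  obtain ⟨u, hu⟩ := hk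
  have hI : Complex.I ^ (k + 3) = (-1) ^ ((k + 3) / 2) := by
    rw [show (k + 3) / 2 = u by omega, hu, ← two_mul, pow_mul, Complex.I_sq]
  rw [hodd.neg_one_pow, hI]
  push_cast
  ring

/-- For odd length the power of `i` in the cycle formula is imaginary, so the gain contributes only
to the imaginary part; the exponent `(s + 1) / 2` absorbs its sign. -/
theorem det_right (hx : 0 < x) (hH : IsHermitianNat H) (h : IsDumbbellMatrix H k t l)
    (ht : Odd (t + 3)) :
    (leadingBlock x (shiftMatrix (k + 3 + l) H) (t + 3)).det =
      (pathPoly x (t + 3) + pathPoly x (t + 1) : ℝ) -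
      ((2 * ((-1) ^ ((t + 3 + 1) / 2) *
        ((∏ i ∈ Finset.range (t + 2), H (k + 3 + l + i) (k + 3 + l + (i + 1))) *
          H (k + 3 + l + (t + 2)) (k + 3 + l)).re) : ℝ)) * Complex.I := by
  rw [det_leadingBlock_of_isCycle hx (hH.shift _) t h.isPathMatrix_right (h.diag _ (by omega))
    (h.normSq_succ (k + 3 + l + (t + 1)) (by omega)) h.normSq_right
    fun i hi hi' => h.eq_zero _ _ (by omega) (by omega) (by omega) (by omega)]
  have heven : Even t := by
    rw [← Nat.not_odd_iff_even]
    intro ht'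
    obtain ⟨a, ha⟩ := ht
    obtain ⟨b, hb⟩ := ht'
    omega
  obtain ⟨u, hu⟩ := ht
  have hI : Complex.I ^ (t + 3) = -(-1) ^ ((t + 3 + 1) / 2) * Complex.I := by
    rw [show (t + 3 + 1) / 2 = u + 1 by omega, hu, pow_succ, pow_mul, Complex.I_sq]
    ring
  rw [heven.neg_one_pow, hI]
  simp only [shiftMatrix, add_zero]
  push_cast
  ring

/-- Each pendant vertex applies the path recursion. It starts from the cycle without its attachment
vertex (`j = 0`) and the cycle itself (`j = 1`); splitting into two fundamental solutions isolates
the only part that depends on the gain. -/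
theorem det_stem (hx : 0 < x) (hH : IsHermitianNat H) (h : IsDumbbellMatrix H k t l) :
    ∀ j, j ≤ l + 1 → (leadingBlock x H (k + 2 + j)).det =
      continuantSeq x 0 1 j * (leadingBlock x H (k + 3)).det +
        (continuantSeq x (pathPoly x (k + 2)) 0 j : ℝ)
  | 0, _ => by
    rw [add_zero, det_leadingBlock_of_isPathMatrix hx hH _ h.isPathMatrix_left]
    simp [continuantSeq]
  | 1, _ => by simp [continuantSeq]
  | j + 2, hj => by
    rw [← add_assoc, det_leadingBlock_add_two hx hH (k + 2 + j) (h.normSq_succ _ (by omega))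
      (h.diag _ (by omega))
      (fun i hi => h.eq_zero _ _ (by omega) (by omega) (by omega) (by omega)),
      add_assoc (k + 2) j 1, det_stem hx hH h (j + 1) (by omega), det_stem hx hH h j (by omega)]
    simp only [continuantSeq]
    push_cast
    ring

theorem det_leadingBlock (hx : 0 < x) (hH : IsHermitianNat H) (h : IsDumbbellMatrix H k t l) :
    (leadingBlock x H (k + 3 + l + (t + 3))).det =
      (leadingBlock x H (k + 2 + (l + 1))).det *
        (leadingBlock x (shiftMatrix (k + 3 + l) H) (t + 3)).det +
      (leadingBlock x H (k + 2 + l)).det * pathPoly x (t + 2) := by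
  have e : k + 3 + l = k + 2 + l + 1 := by omega
  have hb := det_leadingBlock_of_bridge hx hH (k + 2 + l) (t + 2) (h.normSq_succ _ (by omega))
    (fun i j hi hj hj' hij => h.eq_zero i j (by omega) (by omega) (by omega) (by omega))
  rw [show k + 2 + l + 2 = k + 4 + l by omega,
    det_leadingBlock_of_isPathMatrix hx (hH.shift _) _ h.isPathMatrix_right_tail] at hb
  rw [e, hb, ← add_assoc]

end IsDumbbellMatrix

/-! ### Maximizing the squared modulus in `α` and `β` -/

/-- The determinant of the leading part of `x + i A` for a dumbbell: the left cycle with a tail. -/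
noncomputable def lollipopDet (x : ℝ) (k j : ℕ) (α : ℝ) : ℝ :=
  continuantSeq x 0 1 j * (pathPoly x (k + 3) + pathPoly x (k + 1) - 2 * α) +
    continuantSeq x (pathPoly x (k + 2)) 0 j

/-- The squared modulus of `det (x + i A)` for a dumbbell with cycle parameters `α`, `β`. -/
noncomputable def dumbbellNormSq (x : ℝ) (k t l : ℕ) (α β : ℝ) : ℝ :=
  (lollipopDet x k (l + 1) α * (pathPoly x (t + 3) + pathPoly x (t + 1)) +
    lollipopDet x k l α * pathPoly x (t + 2)) ^ 2 + 4 * β ^ 2 * lollipopDet x k (l + 1) α ^ 2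

theorem IsDumbbellMatrix.normSq_det_leadingBlock {H : ℕ → ℕ → ℂ} {k t l : ℕ} {x : ℝ}
    (hx : 0 < x) (hH : IsHermitianNat H) (h : IsDumbbellMatrix H k t l)
    (hk : Even (k + 3)) (ht : Odd (t + 3)) :
    Complex.normSq (leadingBlock x H (k + 3 + l + (t + 3))).det = dumbbellNormSq x k t l
      ((-1) ^ ((k + 3) / 2) * ((∏ i ∈ Finset.range (k + 2), H i (i + 1)) * H (k + 2) 0).re)
      ((-1) ^ ((t + 3 + 1) / 2) *
        ((∏ i ∈ Finset.range (t + 2), H (k + 3 + l + i) (k + 3 + l + (i + 1))) *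
          H (k + 3 + l + (t + 2)) (k + 3 + l)).re) := by
  rw [h.det_leadingBlock hx hH, h.det_stem hx hH _ le_rfl, h.det_stem hx hH _ (Nat.le_succ l),
    h.det_left hx hH hk, h.det_right hx hH ht]
  generalize (-1) ^ ((k + 3) / 2) * ((∏ i ∈ Finset.range (k + 2), H i (i + 1)) * H (k + 2) 0).re = α
  generalize (-1) ^ ((t + 3 + 1) / 2) *
        ((∏ i ∈ Finset.range (t + 2), H (k + 3 + l + i) (k + 3 + l + (i + 1))) *
          H (k + 3 + l + (t + 2)) (k + 3 + l)).re = β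
  have e : ∀ a b c p : ℝ, ((a : ℂ) * (b - (2 * β : ℝ) * Complex.I) + c * p) =
      ((a * b + c * p : ℝ) : ℂ) + ((-(2 * β * a) : ℝ) : ℂ) * Complex.I := by
    intros
    push_cast
    ring
  rw [← Complex.ofReal_mul, ← Complex.ofReal_add, ← Complex.ofReal_mul, ← Complex.ofReal_add,
    e, Complex.normSq_add_mul_I, dumbbellNormSq, lollipopDet, lollipopDet]
  ring

theorem lollipopDet_le (x : ℝ) (hx : 0 < x) (k j : ℕ) {α : ℝ} (h1 : -1 ≤ α) (h2 : α ≤ 1) :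
    |lollipopDet x k j α| ≤ lollipopDet x k j (-1) := by
  have ha := continuantSeq_nonneg hx le_rfl zero_le_one j
  have hb := continuantSeq_nonneg hx (pathPoly_pos hx (k + 2)).le le_rfl j
  have hq := add_pos (pathPoly_pos hx (k + 3)) (pathPoly_pos hx (k + 1))
  rw [abs_le, lollipopDet, lollipopDet]
  constructor <;> nlinarith [mul_nonneg ha (sub_nonneg.mpr h1), mul_nonneg ha (sub_nonneg.mpr h2),
    mul_nonneg ha hq.le]

/-- Strictness needs a positive coefficient of `α`. This fails at index `0`, where the cycle is
broken and `α` is absent. -/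
theorem lollipopDet_succ_lt (x : ℝ) (hx : 0 < x) (k j : ℕ) {α : ℝ} (h1 : -1 < α) (h2 : α ≤ 1) :
    |lollipopDet x k (j + 1) α| < lollipopDet x k (j + 1) (-1) := by
  have ha := continuantSeq_succ_pos hx le_rfl zero_lt_one j
  have hb := continuantSeq_nonneg hx (pathPoly_pos hx (k + 2)).le le_rfl (j + 1)
  have hq := add_pos (pathPoly_pos hx (k + 3)) (pathPoly_pos hx (k + 1))
  rw [abs_lt, lollipopDet, lollipopDet]
  constructor <;> nlinarith [mul_pos ha (sub_pos.mpr h1), mul_nonneg ha.le (sub_nonneg.mpr h2),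
    mul_pos ha hq]

theorem dumbbellNormSq_le {x : ℝ} (hx : 0 < x) (k t l : ℕ) {α β : ℝ} (h1 : -1 ≤ α) (h2 : α ≤ 1)
    (hβ : β ^ 2 ≤ 1) : dumbbellNormSq x k t l α β ≤ dumbbellNormSq x k t l (-1) 1 := by
  have hu := lollipopDet_le x hx k (l + 1) h1 h2
  have hv := lollipopDet_le x hx k l h1 h2
  have hq := add_pos (pathPoly_pos hx (t + 3)) (pathPoly_pos hx (t + 1))
  have hp := pathPoly_pos hx (t + 2)
  unfold dumbbellNormSq
  refine add_le_add (sq_le_sq' ?_ ?_) (mul_le_mul (by linarith) (sq_le_sq' ?_ ?_) (by positivity)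
    (by positivity))
  · nlinarith [(abs_le.mp hu).1, (abs_le.mp hv).1]
  · exact add_le_add (mul_le_mul_of_nonneg_right (abs_le.mp hu).2 hq.le)
      (mul_le_mul_of_nonneg_right (abs_le.mp hv).2 hp.le)
  · exact (abs_le.mp hu).1
  · exact (abs_le.mp hu).2

theorem dumbbellNormSq_lt {x : ℝ} (hx : 0 < x) (k t l : ℕ) {α β : ℝ} (h1 : -1 ≤ α) (h2 : α ≤ 1)
    (hβ : β ^ 2 ≤ 1) (h : ¬(α = -1 ∧ β ^ 2 = 1)) :
    dumbbellNormSq x k t l α β < dumbbellNormSq x k t l (-1) 1 := by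
  have hq := add_pos (pathPoly_pos hx (t + 3)) (pathPoly_pos hx (t + 1))
  have hp := pathPoly_pos hx (t + 2)
  rcases h1.eq_or_lt with rfl | h1'
  · have hβ' : β ^ 2 < 1 := lt_of_le_of_ne hβ fun hβ' => h ⟨rfl, hβ'⟩
    -- Positivity is read off from the strict bound at the auxiliary value `α = 0`.
    have hu : 0 < lollipopDet x k (l + 1) (-1) :=
      (abs_nonneg _).trans_lt (lollipopDet_succ_lt x hx k l (show (-1 : ℝ) < 0 by norm_num)
        zero_le_one)
    unfold dumbbellNormSq
    have := mul_lt_mul_of_pos_right hβ' (pow_pos hu 2)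
    linarith
  · have hu := lollipopDet_succ_lt x hx k l h1' h2
    have hv := lollipopDet_le x hx k l h1 h2
    unfold dumbbellNormSq
    refine add_lt_add_of_lt_of_le (sq_lt_sq' ?_ ?_) (mul_le_mul (by linarith)
      (sq_le_sq' (abs_lt.mp hu).1.le (abs_lt.mp hu).2.le) (by positivity) (by positivity))
    · have := mul_lt_mul_of_pos_right (abs_lt.mp hu).1 hq
      have := mul_le_mul_of_nonneg_right (abs_le.mp hv).1 hp.le
      linarith
    · exact add_lt_add_of_lt_of_le (mul_lt_mul_of_pos_right (abs_lt.mp hu).2 hq)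
        (mul_le_mul_of_nonneg_right (abs_le.mp hv).2 hp.le)

/-! ### Passing from gain graphs to infinite matrices -/

namespace UnitGain

variable {n : ℕ} {G : SimpleGraph (Fin n)}

/-- The Hermitian adjacency matrix of a gain graph on `Fin n`, extended by zero. -/
noncomputable def natMatrix (Φ : UnitGain G) (i j : ℕ) : ℂ :=
  if h : i < n ∧ j < n then Φ.adjMatrix ⟨i, h.1⟩ ⟨j, h.2⟩ else 0

theorem natMatrix_of_lt (Φ : UnitGain G) {i j : ℕ} (hi : i < n) (hj : j < n) :
    Φ.natMatrix i j = Φ.adjMatrix ⟨i, hi⟩ ⟨j, hj⟩ := dif_pos ⟨hi, hj⟩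

theorem natMatrix_of_adj (Φ : UnitGain G) {i j : ℕ} (hi : i < n) (hj : j < n)
    (h : G.Adj ⟨i, hi⟩ ⟨j, hj⟩) : Φ.natMatrix i j = Φ.gain ⟨(⟨i, hi⟩, ⟨j, hj⟩), h⟩ := by
  simp [natMatrix_of_lt Φ hi hj, adjMatrix, h]

theorem natMatrix_of_not_adj (Φ : UnitGain G) {i j : ℕ} (hi : i < n) (hj : j < n)
    (h : ¬G.Adj ⟨i, hi⟩ ⟨j, hj⟩) : Φ.natMatrix i j = 0 := by
  simp [natMatrix_of_lt Φ hi hj, adjMatrix, h]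

theorem normSq_natMatrix_of_adj (Φ : UnitGain G) {i j : ℕ} (hi : i < n) (hj : j < n)
    (h : G.Adj ⟨i, hi⟩ ⟨j, hj⟩) : Complex.normSq (Φ.natMatrix i j) = 1 := by
  rw [natMatrix_of_adj Φ hi hj h, Circle.normSq_coe]

/-- `energy` is built on the classical decidable equality; this form allows any instance, such as
the one on `Fin n`. -/
theorem energy_eq_sum_abs_eigenvalues {V : Type*} [Fintype V] [DecidableEq V]
    {G : SimpleGraph V} (Φ : UnitGain G) :
    Φ.energy = ∑ j, |Φ.adjMatrix_isHermitian.eigenvalues j| := by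
  unfold energy
  congr!

theorem isHermitianNat_natMatrix (Φ : UnitGain G) : IsHermitianNat Φ.natMatrix := by
  intro i j
  by_cases h : i < n ∧ j < n
  · rw [natMatrix_of_lt Φ h.1 h.2, natMatrix_of_lt Φ h.2 h.1]
    exact (Φ.adjMatrix_isHermitian.apply _ _).symm
  · rw [natMatrix, natMatrix, dif_neg h, dif_neg fun h' => h h'.symm, map_zero]

theorem normSq_det_leadingBlock_natMatrix (Φ : UnitGain G) (x : ℝ) :
    Complex.normSq (leadingBlock x Φ.natMatrix n).det =
      ∏ i, (x ^ 2 + Φ.adjMatrix_isHermitian.eigenvalues i ^ 2) := by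
  rw [← Matrix.IsHermitian.normSq_det_smul_one_add_I_smul, leadingBlock]
  have e : (Matrix.of fun i j : Fin n => Φ.natMatrix i j) = Φ.adjMatrix := by
    ext i j
    exact natMatrix_of_lt Φ i.2 j.2
  rw [e]

theorem cycleGain_eq_prod_range (Φ : UnitGain G) {k a : ℕ} (c : Fin (k + 1) → Fin n)
    (hc : ∀ i, G.Adj (c i) (c (finRotate (k + 1) i))) (ha : ∀ i, (c i).val = a + i.val) :
    (Φ.cycleGain c hc : ℂ) =
      (∏ i ∈ Finset.range k, Φ.natMatrix (a + i) (a + (i + 1))) * Φ.natMatrix (a + k) a := by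
  have h : ∀ i, (Φ.gain ⟨(c i, c (finRotate (k + 1) i)), hc i⟩ : ℂ) =
      Φ.natMatrix (a + i.val) (a + (finRotate (k + 1) i).val) := by
    intro i
    simp only [← ha]
    exact (Φ.natMatrix_of_adj (c i).2 (c _).2 (hc i)).symm
  have h' : (Φ.cycleGain c hc : ℂ) =
      ∏ i, (Φ.gain ⟨(c i, c (finRotate (k + 1) i)), hc i⟩ : ℂ) := map_prod Circle.coeHom _ _
  rw [h', Finset.prod_congr rfl fun i _ => h i, Fin.prod_univ_castSucc, Finset.prod_range]
  simp

end UnitGain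

namespace dumbbell

variable {r s ℓ : ℕ}

theorem adj_iff {i j : ℕ} (hi : i < r + s + ℓ - 1) (hj : j < r + s + ℓ - 1) :
    (dumbbell r s ℓ).Adj ⟨i, hi⟩ ⟨j, hj⟩ ↔ i ≠ j ∧
      ((i + 1 = j ∨ (i = 0 ∧ j + 1 = r) ∨ (i + 1 = r + ℓ ∧ j + 2 = r + s + ℓ)) ∨
        (j + 1 = i ∨ (j = 0 ∧ i + 1 = r) ∨ (j + 1 = r + ℓ ∧ i + 2 = r + s + ℓ))) := by
  simp [dumbbell, SimpleGraph.fromRel_adj]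

theorem isDumbbellMatrix_natMatrix {k t l : ℕ}
    (Φ : UnitGain (dumbbell (k + 3) (t + 3) (l + 1))) :
    IsDumbbellMatrix Φ.natMatrix k t l where
  diag i hi := Φ.natMatrix_of_not_adj (by omega) (by omega) (SimpleGraph.irrefl _)
  normSq_succ i hi := Φ.normSq_natMatrix_of_adj (by omega) (by omega)
    ((adj_iff _ _).mpr (by omega))
  normSq_left := Φ.normSq_natMatrix_of_adj (by omega) (by omega) ((adj_iff _ _).mpr (by omega))
  normSq_right := Φ.normSq_natMatrix_of_adj (by omega) (by omega) ((adj_iff _ _).mpr (by omega))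
  eq_zero i j hij hj h1 h2 := Φ.natMatrix_of_not_adj (by omega) (by omega) fun h => by
    rw [adj_iff] at h
    omega

/-- Through this identity the gains influence the energy only by way of `α` and `β²`. -/
theorem prod_sq_add_sq_eigenvalues {k t l : ℕ} (hr : 3 ≤ k + 3) (hs : 3 ≤ t + 3)
    (hk : Even (k + 3)) (ht : Odd (t + 3)) (Φ : UnitGain (dumbbell (k + 3) (t + 3) (l + 1)))
    {x : ℝ} (hx : 0 < x) :
    ∏ i, (x ^ 2 + Φ.adjMatrix_isHermitian.eigenvalues i ^ 2) =
      dumbbellNormSq x k t l (alpha hr hs Φ) (beta hr hs Φ) := by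
  rw [← Φ.normSq_det_leadingBlock_natMatrix, alpha, beta, gainLeft, gainRight,
    Φ.cycleGain_eq_prod_range (a := 0) (leftCycle hs) _ (by simp [leftCycle]),
    Φ.cycleGain_eq_prod_range (a := k + 3 + l) (rightCycle hr) _ (by simp [rightCycle])]
  have h := (isDumbbellMatrix_natMatrix Φ).normSq_det_leadingBlock hx Φ.isHermitianNat_natMatrix
    hk ht
  simp only [zero_add]
  rw [← h, show k + 3 + l + (t + 3) = k + 3 + (t + 3) + (l + 1) - 1 by omega]

theorem abs_alpha_le (hr : 3 ≤ r) (hs : 3 ≤ s) (Φ : UnitGain (dumbbell r s ℓ)) :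
    |alpha hr hs Φ| ≤ 1 := by
  rw [alpha, abs_mul, abs_pow, abs_neg, abs_one, one_pow, one_mul]
  exact (Complex.abs_re_le_norm _).trans (Circle.norm_coe _).le

theorem abs_beta_le (hr : 3 ≤ r) (hs : 3 ≤ s) (Φ : UnitGain (dumbbell r s ℓ)) :
    |beta hr hs Φ| ≤ 1 := by
  rw [beta, abs_mul, abs_pow, abs_neg, abs_one, one_pow, one_mul]
  exact (Complex.abs_re_le_norm _).trans (Circle.norm_coe _).le

/-! ### Gain graphs with prescribed cycle gains -/

open Classical in
/-- The gain graph whose only nontrivial gains are on the closing edges of the two cycles. -/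
noncomputable def ofGains (a b : Circle) : UnitGain (dumbbell r s ℓ) where
  gain d :=
    if d.fst.val + 1 = d.snd.val ∨ d.snd.val + 1 = d.fst.val then 1
    else if d.fst.val + 1 = r then a
    else if d.snd.val + 1 = r then a⁻¹
    else if d.fst.val < d.snd.val then b⁻¹ else b
  gain_symm d := by
    obtain ⟨⟨⟨i, hi⟩, ⟨j, hj⟩⟩, hd⟩ := d
    have h := (adj_iff hi hj).mp hd
    change (if j + 1 = i ∨ i + 1 = j then (1 : Circle)
      else if j + 1 = r then a else if i + 1 = r then a⁻¹ else if j < i then b⁻¹ else b) =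
      (if i + 1 = j ∨ j + 1 = i then (1 : Circle)
      else if i + 1 = r then a else if j + 1 = r then a⁻¹ else if i < j then b⁻¹ else b)⁻¹
    split_ifs <;> first | omega | simp

theorem cycleGain_ofGains (a b : Circle) {k m : ℕ} (c : Fin (k + 3) → Fin (r + s + ℓ - 1))
    (hc : ∀ i, (dumbbell r s ℓ).Adj (c i) (c (finRotate (k + 3) i)))
    (hm : ∀ i, (c i).val = m + i.val) :
    (ofGains a b).cycleGain c hc = if m + (k + 2) + 1 = r then a else if m + 1 = r then a⁻¹ else b := by
  have hlast : ¬ c (Fin.last (k + 2)) < c 0 := by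
    rw [Fin.lt_def, hm, hm]
    simp
  rw [UnitGain.cycleGain, Fin.prod_univ_castSucc, Finset.prod_eq_one, one_mul]
  · simp [ofGains, hm, hlast]
    omega
  · intro i _
    simp [ofGains, hm]
    omega

theorem exists_circle_re {δ : ℝ} (h : δ = 1 ∨ δ = -1) : ∃ a : Circle, (a : ℂ).re = δ := by
  rcases h with rfl | rfl
  · exact ⟨1, by simp⟩
  · exact ⟨Circle.exp Real.pi, by simp [Circle.coe_exp]⟩

theorem exists_alpha_beta (hr : 3 ≤ r) (hs : 3 ≤ s) (hℓ : 1 ≤ ℓ) {α β : ℝ}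
    (hα : α = 1 ∨ α = -1) (hβ : β = 1 ∨ β = -1) :
    ∃ Φ : UnitGain (dumbbell r s ℓ), alpha hr hs Φ = α ∧ beta hr hs Φ = β := by
  have hsign : ∀ (m : ℕ) {γ : ℝ}, (γ = 1 ∨ γ = -1) → (-1) ^ m * γ = 1 ∨ (-1) ^ m * γ = -1 := by
    intro m γ hγ
    rcases neg_one_pow_eq_or ℝ m with hm | hm <;> rcases hγ with rfl | rfl <;> simp [hm]
  -- The sign in the definition of `α` is its own inverse, so `(-1)^(r/2) α` is the real part to
  -- prescribe; likewise for `β`.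
  obtain ⟨a, ha⟩ := exists_circle_re (hsign (r / 2) hα)
  obtain ⟨b, hb⟩ := exists_circle_re (hsign ((s + 1) / 2) hβ)
  obtain ⟨k, rfl⟩ : ∃ k, r = k + 3 := ⟨r - 3, by omega⟩
  obtain ⟨t, rfl⟩ : ∃ t, s = t + 3 := ⟨s - 3, by omega⟩
  refine ⟨ofGains a b, ?_, ?_⟩
  · rw [alpha, gainLeft, cycleGain_ofGains (m := 0) a b _ _ (by simp [leftCycle]),
      if_pos (by omega), ha, ← mul_assoc, ← mul_pow, neg_one_mul, neg_neg, one_pow, one_mul]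
  · rw [beta, gainRight, cycleGain_ofGains (m := k + 3 + ℓ - 1) a b _ _ (by simp [rightCycle]),
      if_neg (by omega), if_neg (by omega), hb, ← mul_assoc, ← mul_pow, neg_one_mul, neg_neg,
      one_pow, one_mul]

end dumbbell

theorem mainTheorem7 (r s ℓ : ℕ) (hr : 3 ≤ r) (hs : 3 ≤ s) (hℓ : 1 ≤ ℓ)
    (hr_even : Even r) (hs_odd : Odd s) :
    (∀ Φ : UnitGain (dumbbell r s ℓ),
      (∀ Ψ : UnitGain (dumbbell r s ℓ), Ψ.energy ≤ Φ.energy) ↔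
        dumbbell.alpha hr hs Φ = -1 ∧
          (dumbbell.beta hr hs Φ = 1 ∨ dumbbell.beta hr hs Φ = -1)) ∧
    (∃ Φ : UnitGain (dumbbell r s ℓ),
      dumbbell.alpha hr hs Φ = -1 ∧ dumbbell.beta hr hs Φ = 1) ∧
    (∃ Φ : UnitGain (dumbbell r s ℓ),
      dumbbell.alpha hr hs Φ = -1 ∧ dumbbell.beta hr hs Φ = -1) := by
  have hex := dumbbell.exists_alpha_beta (ℓ := ℓ) hr hs hℓ (Or.inr rfl : (-1 : ℝ) = 1 ∨ _)
    (Or.inl rfl : (1 : ℝ) = 1 ∨ _)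
  refine ⟨fun Φ => ?_, hex, dumbbell.exists_alpha_beta hr hs hℓ (Or.inr rfl) (Or.inr rfl)⟩
  obtain ⟨Φ₀, hα₀, hβ₀⟩ := hex
  obtain ⟨k, rfl⟩ : ∃ k, r = k + 3 := ⟨r - 3, by omega⟩
  obtain ⟨t, rfl⟩ : ∃ t, s = t + 3 := ⟨s - 3, by omega⟩
  obtain ⟨l, rfl⟩ : ∃ l, ℓ = l + 1 := ⟨ℓ - 1, by omega⟩
  have hprod := fun (Ψ : UnitGain (dumbbell (k + 3) (t + 3) (l + 1))) (x : ℝ) (hx : 0 < x) =>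
    dumbbell.prod_sq_add_sq_eigenvalues hr hs hr_even hs_odd Ψ hx
  constructor
  · intro hmax
    by_contra hne
    -- `Φ₀` has parameters `(-1, 1)` and beats every graph that violates the condition.
    refine (hmax Φ₀).not_gt ?_
    rw [Φ.energy_eq_sum_abs_eigenvalues, Φ₀.energy_eq_sum_abs_eigenvalues]
    refine sum_abs_lt_of_prod_sq_add_sq_lt fun x hx => ?_
    rw [hprod Φ x hx, hprod Φ₀ x hx, hα₀, hβ₀]
    have hα := abs_le.mp (dumbbell.abs_alpha_le hr hs Φ)
    exact dumbbellNormSq_lt hx k t l hα.1 hα.2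
      ((sq_le_one_iff_abs_le_one _).mpr (dumbbell.abs_beta_le hr hs Φ))
      fun h => hne ⟨h.1, by simpa using h.2⟩
  · rintro ⟨hα, hβ⟩ Ψ
    rw [Φ.energy_eq_sum_abs_eigenvalues, Ψ.energy_eq_sum_abs_eigenvalues]
    refine sum_abs_le_of_prod_sq_add_sq_le fun x hx => ?_
    have hαΨ := abs_le.mp (dumbbell.abs_alpha_le hr hs Ψ)
    have h := dumbbellNormSq_le hx k t l hαΨ.1 hαΨ.2
      ((sq_le_one_iff_abs_le_one _).mpr (dumbbell.abs_beta_le hr hs Ψ))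
    have e : dumbbellNormSq x k t l (-1) (dumbbell.beta hr hs Φ) =
        dumbbellNormSq x k t l (-1) 1 := by
      rcases hβ with h | h <;> simp [dumbbellNormSq, h]
    rw [hprod Φ x hx, hprod Ψ x hx, hα, e]
    exact h
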